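/- Let $M=S^1\times D^2$ be the solid torus. A link diagram $D$ in $M$ is a nonempty link diagram in the punctured disk $D^2\setminus\{0\}$; the puncture is called the dot. A state $S$ of $D$ is a choice of $A$- or $B$-smoothing at every crossing; let $a(S)$ and $b(S)$ be the numbers of $A$- and of $B$-smoothings, $|S|$ the number of circles of the smoothed diagram, and $|T_S|$ the number of those circles that go around the dot. The generalized Kauffman bracket of $D$ is $$\langle D\rangle=\sum_{S}A^{a(S)-b(S)}\,(-A^{2}-A^{-2})^{|S|-1}\,t^{|T_S|}\in\mathbb Z[A^{\pm1},t].$$ A crossing $c$ of $D$ is nugatory if there is a simple closed curve in the punctured disk that meets $D$ only in the double point $c$ and there passes through two opposite corners of $c$. A nugatory crossing is dotted-irreducible if no such curve is contractible in the punctured disk. The diagram $D$ is dotted-reduced if each of its nugatory crossings (if there are any) is dotted-irreducible. It is alternating if over- and under-passages alternate along each component, and connected if its projection, with all crossings kept as double points, is a connected subset of the disk. **Theorem.** Let $D$ be a connected, alternating, dotted-reduced link diagram in the solid torus with $n$ crossings. Then $\langle D\rangle\neq 0$ and $$\operatorname{span}_A\langle D\rangle=\max\deg_A\langle D\rangle-\min\deg_A\langle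 D\rangle=4n .$$ -/

import Mathlib

open scoped LaurentPolynomial

/-- A planar-diagram code with `n` crossings. The four ends of a crossing are numbered
`0, 1, 2, 3` counterclockwise; ends `0, 2` belong to the under-strand and ends `1, 3` to the
over-strand. Outside the crossings, the diagram consists of arcs, each joining two ends, and of
`numLoops` closed components without crossings. -/
structure PDCode (n : ℕ) where
  /-- the number of components that pass through no crossing -/
  numLoops : ℕ
  /-- the other end of the arc that starts at a given end -/
  join : Fin n × Fin 4 → Fin n × Fin 4
  join_join : ∀ e, join (join e) = e
  join_ne : ∀ e, join e ≠ e

namespace PDCode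

variable {n : ℕ}

/-- The oriented edges of the diagram: `inl (c, i)` is the arc at the end `i` of the crossing `c`,
oriented away from `c`; `inr (l, b)` is the crossingless loop `l` with one of its two
orientations. -/
abbrev Dart (P : PDCode n) : Type := (Fin n × Fin 4) ⊕ (Fin P.numLoops × Bool)

/-- The same edge with the opposite orientation. -/
def flip (P : PDCode n) : P.Dart → P.Dart
  | Sum.inl e => Sum.inl (P.join e)
  | Sum.inr (l, b) => Sum.inr (l, !b)

/-- Two oriented edges touch if they are the same edge up to orientation or start at neighbouring
ends of one crossing. -/
inductive Touch (P : PDCode n) : P.Dart → P.Dart → Prop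
  | edge (d : P.Dart) : Touch P d (P.flip d)
  | vertex (c : Fin n) (i : Fin 4) : Touch P (Sum.inl (c, i)) (Sum.inl (c, i + 1))

/-- The connected components of the underlying projection (a subset of the plane). -/
def Piece (P : PDCode n) : Type := Quot P.Touch

/-- The connected component of the projection that contains an edge. -/
def piece (P : PDCode n) (d : P.Dart) : P.Piece := Quot.mk _ d

end PDCode

/-- A (nonempty) link diagram with `n` crossings in the solid torus, i.e. in a disk with one
marked point, the dot; up to isotopy of the punctured disk. The disk is the sphere minus an open
disk, so the diagram is a diagram in the sphere together with the complementary region that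
contains the dot and the complementary region that contains the boundary of the disk (the two
may coincide). A diagram in the sphere is a planar-diagram code together with its complementary
regions. -/
structure SolidTorusDiagram (n : ℕ) extends PDCode n where
  /-- the number of connected components of the complement of the projection in the sphere -/
  numRegions : ℕ
  /-- the region to the left of an oriented edge; the region to the left of `inl (c, i)` contains
  the corner of `c` between the ends `i` and `i + 1` -/
  region : toPDCode.Dart → Fin numRegions
  region_surjective : Function.Surjective region
  /-- the corner between the ends `i` and `i + 1` lies to the right of the edge leaving at
  `i + 1`, i.e. to the left of this edge when it is reversed -/
  region_corner : ∀ c i,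
    region (toPDCode.flip (Sum.inl (c, i + 1))) = region (Sum.inl (c, i))
  /-- the surface formed by the projection and the regions is connected -/
  surface_connected : ∀ d e, Relation.EqvGen
    (fun x y => toPDCode.piece x = toPDCode.piece y ∨ region x = region y) d e
  /-- Euler's formula `V - E + R = 1 + K` for a graph with `K` components drawn on the sphere,
  here with `E - V = n`. Together with connectedness it says that the surface is a sphere. -/
  euler : numRegions = n + 1 + Nat.card toPDCode.Piece
  /-- the region that contains the dot -/
  dot : Fin numRegions
  /-- the region that contains the boundary of the disk -/
  outer : Fin numRegions

/-- The two smoothings of a crossing. -/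
inductive Smoothing
  | A
  | B
  deriving DecidableEq

instance : Fintype Smoothing := ⟨{.A, .B}, fun x => by cases x <;> decide⟩

/-- The end to which the end `i` of a crossing is connected by a smoothing. The `A`-smoothing
opens the corners swept out when the over-strand `1, 3` is turned counterclockwise, so it connects
`0` with `1` and `2` with `3`; the `B`-smoothing connects `1` with `2` and `3` with `0`. -/
def Smoothing.partner : Smoothing → Fin 4 → Fin 4
  | .A => ![1, 0, 3, 2]
  | .B => ![3, 2, 1, 0]

/-- Whether the end `i` of a crossing belongs to the over-strand. -/
def isOver : Fin 4 → Bool := ![false, true, false, true]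

/-- The maximal exponent of `A` in a nonzero element of `ℤ[t][A, A⁻¹]`. -/
noncomputable def maxDegA (f : (Polynomial ℤ)[T;T⁻¹]) : ℤ := sSup {k : ℤ | f.coeff k ≠ 0}

/-- The minimal exponent of `A` in a nonzero element of `ℤ[t][A, A⁻¹]`. -/
noncomputable def minDegA (f : (Polynomial ℤ)[T;T⁻¹]) : ℤ := sInf {k : ℤ | f.coeff k ≠ 0}

/-- The `A`-span of a nonzero element of `ℤ[t][A, A⁻¹]`. -/
noncomputable def spanA (f : (Polynomial ℤ)[T;T⁻¹]) : ℤ := maxDegA f - minDegA f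

namespace SolidTorusDiagram

variable {n : ℕ}

/-- The projection of the diagram is connected. -/
def Connected (D : SolidTorusDiagram n) : Prop := ∀ d e : D.Dart, D.piece d = D.piece e

/-- Along every component, over- and under-passages alternate: each arc between two consecutive
crossing passages has one over-end and one under-end. -/
def Alternating (D : SolidTorusDiagram n) : Prop :=
  ∀ e : Fin n × Fin 4, isOver (D.join e).2 ≠ isOver e.2

/-! ### The bracket -/

/-- Two oriented edges are consecutive on a circle of the state `s`: they are the same edge, or
start at two ends that the smoothing of a crossing connects. -/
inductive StateTouch (D : SolidTorusDiagram n) (s : Fin n → Smoothing) : D.Dart → D.Dart → Prop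
  | edge (d : D.Dart) : StateTouch D s d (D.flip d)
  | smooth (c : Fin n) (i : Fin 4) :
      StateTouch D s (Sum.inl (c, i)) (Sum.inl (c, (s c).partner i))

/-- The circles of the state `s`. -/
def StateCircle (D : SolidTorusDiagram n) (s : Fin n → Smoothing) : Type := Quot (D.StateTouch s)

/-- The circle of the state `s` that contains a given edge. -/
def stateCircle (D : SolidTorusDiagram n) (s : Fin n → Smoothing) (d : D.Dart) :
    D.StateCircle s := Quot.mk _ d

/-- A state circle goes around the dot if it separates the dot from the boundary of the disk: the
dot and the boundary lie on different sides when the regions are divided into two sides so that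
one changes sides exactly when crossing an edge of the circle. -/
def GoesAroundDot (D : SolidTorusDiagram n) {s : Fin n → Smoothing} (C : D.StateCircle s) :
    Prop :=
  ∃ side : Fin D.numRegions → Bool,
    (∀ d : D.Dart, side (D.region d) ≠ side (D.region (D.flip d)) ↔ D.stateCircle s d = C) ∧
      side D.dot ≠ side D.outer

/-- `|S|`, the number of circles of a state. -/
noncomputable def numCircles (D : SolidTorusDiagram n) (s : Fin n → Smoothing) : ℕ :=
  Nat.card (D.StateCircle s)

/-- `|T|`, the number of circles of a state that go around the dot. -/
noncomputable def numDotCircles (D : SolidTorusDiagram n) (s : Fin n → Smoothing) : ℕ :=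
  Nat.card {C : D.StateCircle s // D.GoesAroundDot C}

/-- The number of crossings at which the state `s` has the smoothing `x`. -/
def numSmoothings (s : Fin n → Smoothing) (x : Smoothing) : ℕ :=
  (Finset.univ.filter fun c => s c = x).card

/-- The contribution `A ^ (a - b) (-A² - A⁻²) ^ (|S| - 1) t ^ |T|` of a state, in
`ℤ[t][A, A⁻¹]`. -/
noncomputable def contribution (D : SolidTorusDiagram n) (s : Fin n → Smoothing) :
    (Polynomial ℤ)[T;T⁻¹] :=
  LaurentPolynomial.T ((numSmoothings s .A : ℤ) - (numSmoothings s .B : ℤ)) *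
    (-LaurentPolynomial.T 2 - LaurentPolynomial.T (-2)) ^ (D.numCircles s - 1) *
    LaurentPolynomial.C (Polynomial.X ^ D.numDotCircles s)

/-- The generalized Kauffman bracket of a diagram in the solid torus. -/
noncomputable def bracket (D : SolidTorusDiagram n) : (Polynomial ℤ)[T;T⁻¹] :=
  ∑ s : Fin n → Smoothing, D.contribution s

/-! ### Nugatory crossings -/

/-- A simple closed curve in the punctured disk that meets the diagram only in the double point
`c` and crosses it there (so that it passes through two opposite corners of `c`), up to isotopy.
Apart from `c`, the curve runs inside one region, and it is determined by that region's two
corners at `c` and by what lies on which of its two sides. -/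
structure CurveThrough (D : SolidTorusDiagram n) (c : Fin n) where
  /-- the curve leaves `c` through the corner between the ends `corner` and `corner + 1`, and
  returns through the opposite one -/
  corner : Fin 4
  /-- both corners lie in the region in which the curve runs -/
  same_region : D.region (Sum.inl (c, corner + 2)) = D.region (Sum.inl (c, corner))
  /-- the side of the curve on which an edge lies -/
  side : D.Dart → Bool
  side_flip : ∀ d, side (D.flip d) = side d
  side_vertex : ∀ c' i, c' ≠ c → side (Sum.inl (c', i + 1)) = side (Sum.inl (c', i))
  side_left : side (Sum.inl (c, corner + 1)) = side (Sum.inl (c, corner + 2))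
  side_right : side (Sum.inl (c, corner + 3)) = side (Sum.inl (c, corner))
  side_ne : side (Sum.inl (c, corner)) ≠ side (Sum.inl (c, corner + 1))
  /-- the other regions are disjoint from the curve -/
  side_region : ∀ d e, D.region d = D.region e →
    D.region d ≠ D.region (Sum.inl (c, corner)) → side d = side e
  /-- the side of the curve on which the dot lies -/
  dotSide : Bool
  /-- the side of the curve on which the boundary of the disk lies -/
  outerSide : Bool
  side_dot : ∀ d, D.region d = D.dot →
    D.region d ≠ D.region (Sum.inl (c, corner)) → side d = dotSide
  side_outer : ∀ d, D.region d = D.outer →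
    D.region d ≠ D.region (Sum.inl (c, corner)) → side d = outerSide

/-- A simple closed curve in the punctured disk is contractible if and only if it does not separate
the puncture from the boundary of the disk. -/
def CurveThrough.Contractible {D : SolidTorusDiagram n} {c : Fin n} (γ : D.CurveThrough c) :
    Prop := γ.dotSide = γ.outerSide

/-- Every simple closed curve in the punctured disk separates it. -/
def Nugatory (D : SolidTorusDiagram n) (c : Fin n) : Prop := Nonempty (D.CurveThrough c)

/-- A nugatory crossing without a contractible curve through it. -/
def DottedIrreducible (D : SolidTorusDiagram n) (c : Fin n) : Prop :=
  D.Nugatory c ∧ ¬ ∃ γ : D.CurveThrough c, γ.Contractible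

/-- All nugatory crossings, if there are any, are dotted-irreducible. -/
def DottedReduced (D : SolidTorusDiagram n) : Prop :=
  ∀ c, D.Nugatory c → D.DottedIrreducible c

end SolidTorusDiagram

/-! ### Laurent polynomials -/

/-! The argument refines the Kauffman–Murasugi–Thistlethwaite one. Let `S_x` be the state with only
`x`-smoothings. Changing `j` smoothings of `S_x` moves the exponent of `A` inwards by `2 * j` and
adds at most `j` circles (`numCircles_le_add_card`), so no state exceeds the extreme exponent of
`S_x`. The number of circles drops at the first change if that change joins two circles
(`numCircles_update_lt`); then the extreme exponent is missed.

In an alternating diagram the circles of `S_x` are the boundaries of one checkerboard class of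
regions. Other states can therefore reach the extreme exponent only by changing crossings whose two
`x`-corners lie in one region `R`. A curve in `R` through such a crossing separates the dot from the
outer boundary, both of which lie outside `R`. The change splits `∂R`, which does not go around the
dot, and creates a circle that does, while every old dot circle still contributes one
(`numDotCircles_lt`). So these states have larger powers of `t`, and the extreme term of `S_x`
survives. The two classes contain `n + 2` regions in all, which gives the span.

Planarity enters through linear algebra over `ZMod 2`. The inequality "genus is at least zero" shows
that region boundaries are single closed paths and that curves through a crossing disconnect; its
equality case shows that cycles bound. -/

theorem LaurentPolynomial.coeff_mul_T {R : Type*} [Semiring R] (f : R[T;T⁻¹]) (a k : ℤ) :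
    (f * LaurentPolynomial.T a).coeff k = f.coeff (k - a) := by
  rw [LaurentPolynomial.T, AddMonoidAlgebra.coeff_mul_single_apply, mul_one, sub_eq_add_neg]

theorem LaurentPolynomial.coeff_mul_C {R : Type*} [Semiring R] (f : R[T;T⁻¹]) (r : R) (k : ℤ) :
    (f * LaurentPolynomial.C r).coeff k = f.coeff k * r := by
  rw [← LaurentPolynomial.single_eq_C, AddMonoidAlgebra.coeff_mul_single_apply]
  simp

/-- The loop value `-A² - A⁻²`. -/
noncomputable def loopValue : (Polynomial ℤ)[T;T⁻¹] :=
  -LaurentPolynomial.T 2 - LaurentPolynomial.T (-2)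

theorem coeff_loopValue_pow_succ (m : ℕ) (k : ℤ) :
    (loopValue ^ (m + 1)).coeff k
      = -(loopValue ^ m).coeff (k - 2) - (loopValue ^ m).coeff (k + 2) := by
  have h : loopValue ^ (m + 1) = -(loopValue ^ m * LaurentPolynomial.T 2)
      - loopValue ^ m * LaurentPolynomial.T (-2) := by
    rw [pow_succ]
    nth_rw 2 [loopValue]
    ring
  simp only [h, AddMonoidAlgebra.coeff_sub, AddMonoidAlgebra.coeff_neg,
    Finsupp.sub_apply, Finsupp.neg_apply, LaurentPolynomial.coeff_mul_T, sub_neg_eq_add]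

/-- The sign `ε` selects the top or the bottom degree, so both extreme states are treated at once.
In the recursion one of the two neighbouring coefficients is always out of range. -/
theorem coeff_loopValue_pow {ε : ℤ} (hε : ε = 1 ∨ ε = -1) (m : ℕ) :
    (loopValue ^ m).coeff (ε * (2 * m)) = (-1) ^ m ∧
      ∀ k : ℤ, 2 * (m : ℤ) < k → (loopValue ^ m).coeff (ε * k) = 0 := by
  induction m with
  | zero =>
    simp only [pow_zero, AddMonoidAlgebra.one_def, AddMonoidAlgebra.coeff_single]
    refine ⟨by simp, fun k hk => ?_⟩
    rw [Finsupp.single_apply, if_neg]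
    rcases hε with rfl | rfl <;> push_cast at hk <;> omega
  | succ m ih =>
    obtain ⟨h1, h2⟩ := ih
    rcases hε with rfl | rfl
    · simp only [one_mul] at h1 h2 ⊢
      refine ⟨?_, fun k hk => ?_⟩
      · rw [coeff_loopValue_pow_succ, h2 (_ + 2) (by push_cast; omega), sub_zero, pow_succ, ← h1]
        push_cast
        ring_nf
      · rw [coeff_loopValue_pow_succ, h2 _ (by push_cast at hk; omega),
          h2 _ (by push_cast at hk; omega)]
        simp
    · simp only [neg_mul, one_mul] at h1 h2 ⊢
      have key : ∀ k : ℤ, (loopValue ^ (m + 1)).coeff (-k)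
          = -(loopValue ^ m).coeff (-(k + 2)) - (loopValue ^ m).coeff (-(k - 2)) := fun k => by
        rw [coeff_loopValue_pow_succ, neg_add', neg_sub, sub_eq_neg_add (2 : ℤ), sub_eq_add_neg]
      refine ⟨?_, fun k hk => ?_⟩
      · rw [key, h2 (_ + 2) (by push_cast; omega), neg_zero, zero_sub, pow_succ, ← h1]
        push_cast
        ring_nf
      · rw [key, h2 _ (by push_cast at hk; omega), h2 _ (by push_cast at hk; omega)]
        simp

/-! ### Cycles and boundaries modulo two -/

/-- For a map `reg` from the darts `E` to the faces, and an involution `J` that reverses darts, the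
coboundary of a function on the faces: its jump across each edge. -/
def faceCoboundary {E Φ : Type*} (J : E → E) (reg : E → Φ) :
    (Φ → ZMod 2) →ₗ[ZMod 2] (E → ZMod 2) where
  toFun f e := f (reg e) + f (reg (J e))
  map_add' f g := by ext e; simp; ring
  map_smul' a f := by ext e; simp; ring

/-- The functions on the darts that are invariant under reversal and have an even sum at every
vertex. -/
def cycleSpace {E V : Type*} [Fintype E] [DecidableEq V] (J : E → E) (v : E → V) :
    Submodule (ZMod 2) (E → ZMod 2) where
  carrier := {h | (∀ e, h (J e) = h e) ∧ ∀ w, ∑ e, (if v e = w then h e else 0) = 0}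
  zero_mem' := by simp
  add_mem' := by
    rintro a b ⟨ha, ha'⟩ ⟨hb, hb'⟩
    refine ⟨fun e => by simp [ha, hb], fun w => ?_⟩
    have := congrArg₂ (· + ·) (ha' w) (hb' w)
    simp only [← Finset.sum_add_distrib, add_zero] at this
    refine (Finset.sum_congr rfl fun e _ => ?_).trans this
    split_ifs <;> simp
  smul_mem' := by
    rintro c a ⟨ha, ha'⟩
    refine ⟨fun e => by simp [ha], fun w => ?_⟩
    have := congrArg (c * ·) (ha' w)
    simp only [Finset.mul_sum, mul_zero] at this
    refine (Finset.sum_congr rfl fun e _ => ?_).trans this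
    split_ifs <;> simp

section Genus

variable {E V Φ : Type*} [Fintype E] [DecidableEq V] {J : E → E} {v : E → V}

/-- The darts' functions that are invariant under reversal. -/
def invariantSpace {E : Type*} (J : E → E) : Submodule (ZMod 2) (E → ZMod 2) :=
  LinearMap.ker (LinearMap.id + LinearMap.funLeft (ZMod 2) (ZMod 2) J)

theorem mem_invariantSpace {E : Type*} {J : E → E} {h : E → ZMod 2} : h ∈ invariantSpace J ↔ ∀ e, h (J e) = h e := by
  simp only [invariantSpace, LinearMap.mem_ker, funext_iff, LinearMap.add_apply, LinearMap.id_apply,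
    Pi.add_apply, LinearMap.funLeft_apply, Pi.zero_apply]
  exact forall_congr' fun e => by rw [CharTwo.add_eq_zero, eq_comm]

/-- In characteristic two, `1 + J*` squares to zero because `J` is an involution. Its range thus
lies in its kernel, and rank-nullity applies. -/
theorem card_le_two_mul_finrank_invariantSpace (hJ : Function.Involutive J) :
    Fintype.card E ≤ 2 * Module.finrank (ZMod 2) (invariantSpace J) := by
  have h := LinearMap.finrank_range_add_finrank_ker
    (LinearMap.id + LinearMap.funLeft (ZMod 2) (ZMod 2) J)
  rw [Module.finrank_fintype_fun_eq_card] at h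
  have hle : LinearMap.range (LinearMap.id + LinearMap.funLeft (ZMod 2) (ZMod 2) J)
      ≤ invariantSpace J := by
    rintro _ ⟨g, rfl⟩
    rw [mem_invariantSpace]
    intro e
    simp [LinearMap.funLeft_apply, hJ e, add_comm]
  have := Submodule.finrank_mono hle
  rw [invariantSpace] at *
  omega

theorem sum_mul_eq_zero_of_invariant (hJ : Function.Involutive J) (hJ' : ∀ e, J e ≠ e)
    {g h : E → ZMod 2} (hg : ∀ e, g (J e) = g e) (hh : ∀ e, h (J e) = h e) :
    ∑ e, g e * h e = 0 := by
  refine Finset.sum_involution (fun e _ => J e) (fun e _ => ?_) (fun e _ _ => hJ' e)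
    (fun e _ => Finset.mem_univ _) (fun e _ => hJ e)
  rw [hg, hh, CharTwo.add_self_eq_zero]

/-- Cycles are orthogonal both to the invariant functions and to the functions pulled back from
vertices. These two spaces share only constants, so their sum is large. `E` counts darts, two per
edge, whence the factors 2. -/
theorem finrank_cycleSpace_le [Fintype V] (hJ : Function.Involutive J) (hJ' : ∀ e, J e ≠ e)
    (hv : Function.Surjective v)
    (hconn : ∀ g : V → ZMod 2, (∀ e, g (v (J e)) = g (v e)) → ∀ a b, g a = g b) :
    2 * Module.finrank (ZMod 2) (cycleSpace J v) + 2 * Fintype.card V ≤ Fintype.card E + 2 := by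
  classical
  let S : Submodule (ZMod 2) (E → ZMod 2) :=
    LinearMap.range (LinearMap.funLeft (ZMod 2) (ZMod 2) v)
  have hS : Module.finrank (ZMod 2) S = Fintype.card V := by
    rw [LinearMap.finrank_range_of_inj (LinearMap.funLeft_injective_of_surjective _ _ _ hv),
      Module.finrank_fintype_fun_eq_card]
  have hinf : Module.finrank (ZMod 2) (invariantSpace J ⊓ S : Submodule _ _) ≤ 1 := by
    refine (Submodule.finrank_mono (t := Submodule.span (ZMod 2) {fun _ => 1}) ?_).trans
      (finrank_span_le_card _ |>.trans (by simp))
    rintro _ ⟨hI, g, rfl⟩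
    have hg := hconn g (mem_invariantSpace.1 hI)
    rw [Submodule.mem_span_singleton]
    rcases isEmpty_or_nonempty E with hE | ⟨⟨e₀⟩⟩
    · exact ⟨0, Subsingleton.elim _ _⟩
    · exact ⟨g (v e₀), by ext e; simp [LinearMap.funLeft_apply, hg (v e) (v e₀)]⟩
  have hsup := Submodule.finrank_sup_add_finrank_inf_eq (invariantSpace J) S
  have hann := Subspace.finrank_add_finrank_dualAnnihilator_eq (invariantSpace J ⊔ S)
  rw [Module.finrank_fintype_fun_eq_card] at hann
  have hle : (cycleSpace J v).map (dotProductEquiv (ZMod 2) E).toLinearMap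
      ≤ (invariantSpace J ⊔ S).dualAnnihilator := by
    rintro _ ⟨h, ⟨h1, h2⟩, rfl⟩
    rw [Submodule.dualAnnihilator_sup_eq, Submodule.mem_inf]
    constructor <;> rw [Submodule.mem_dualAnnihilator]
    · intro g hg
      exact sum_mul_eq_zero_of_invariant hJ hJ' h1 (mem_invariantSpace.1 hg)
    · rintro _ ⟨g, rfl⟩
      change ∑ e, h e * g (v e) = 0
      -- Sorting the dot product by vertices exposes the parity condition of a cycle.
      have : ∀ e, h e * g (v e) = ∑ w, g w * (if v e = w then h e else 0) := fun e => by
        simp [mul_comm]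
      simp_rw [this]
      rw [Finset.sum_comm]
      simp_rw [← Finset.mul_sum, h2]
      simp
  have hfin := Submodule.finrank_mono hle
  rw [LinearEquiv.finrank_map_eq (dotProductEquiv (ZMod 2) E)] at hfin
  have := card_le_two_mul_finrank_invariantSpace hJ
  omega

theorem card_le_finrank_range_faceCoboundary_add_one {E Φ : Type*} [Fintype Φ] {J : E → E} {reg : E → Φ}
    (hker : ∀ f, faceCoboundary J reg f = 0 → ∀ a b, f a = f b) :
    Fintype.card Φ ≤ Module.finrank (ZMod 2) (LinearMap.range (faceCoboundary J reg)) + 1 := by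
  have h := LinearMap.finrank_range_add_finrank_ker (faceCoboundary J reg)
  rw [Module.finrank_fintype_fun_eq_card] at h
  have : Module.finrank (ZMod 2) (LinearMap.ker (faceCoboundary J reg)) ≤ 1 := by
    refine (Submodule.finrank_mono (t := Submodule.span (ZMod 2) {fun _ => 1}) ?_).trans
      (finrank_span_le_card _ |>.trans (by simp))
    intro f hf
    rw [Submodule.mem_span_singleton]
    rcases isEmpty_or_nonempty Φ with hE | ⟨⟨e₀⟩⟩
    · exact ⟨0, Subsingleton.elim _ _⟩
    · exact ⟨f e₀, by ext e; simp [hker f hf e e₀]⟩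
  omega

/-- The genus of a closed surface with a connected cell structure is nonnegative. -/
theorem two_mul_card_faces_add_le [Fintype V] [Fintype Φ] {reg : E → Φ}
    (hJ : Function.Involutive J) (hJ' : ∀ e, J e ≠ e) (hv : Function.Surjective v)
    (hconn : ∀ g : V → ZMod 2, (∀ e, g (v (J e)) = g (v e)) → ∀ a b, g a = g b)
    (hker : ∀ f, faceCoboundary J reg f = 0 → ∀ a b, f a = f b)
    (hcyc : ∀ f, faceCoboundary J reg f ∈ cycleSpace J v) :
    2 * Fintype.card Φ + 2 * Fintype.card V ≤ Fintype.card E + 4 := by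
  have h1 := finrank_cycleSpace_le hJ hJ' hv hconn
  have h2 := card_le_finrank_range_faceCoboundary_add_one hker
  have h3 : LinearMap.range (faceCoboundary J reg) ≤ cycleSpace J v := by
    rintro _ ⟨f, rfl⟩; exact hcyc f
  have := Submodule.finrank_mono h3
  omega

/-- On a surface of genus zero every cycle is a boundary. -/
theorem exists_faceCoboundary_eq [Fintype V] [Fintype Φ] {reg : E → Φ}
    (hJ : Function.Involutive J) (hJ' : ∀ e, J e ≠ e) (hv : Function.Surjective v)
    (hconn : ∀ g : V → ZMod 2, (∀ e, g (v (J e)) = g (v e)) → ∀ a b, g a = g b)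
    (hker : ∀ f, faceCoboundary J reg f = 0 → ∀ a b, f a = f b)
    (hcyc : ∀ f, faceCoboundary J reg f ∈ cycleSpace J v)
    (hcard : Fintype.card E + 4 ≤ 2 * Fintype.card Φ + 2 * Fintype.card V)
    {h : E → ZMod 2} (hh : h ∈ cycleSpace J v) : ∃ f, faceCoboundary J reg f = h := by
  have h1 := finrank_cycleSpace_le hJ hJ' hv hconn
  have h2 := card_le_finrank_range_faceCoboundary_add_one hker
  have h3 : LinearMap.range (faceCoboundary J reg) ≤ cycleSpace J v := by
    rintro _ ⟨f, rfl⟩; exact hcyc f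
  -- Boundaries have dimension at least `F - 1`, cycles at most `E / 2 - V + 1`; `hcard` closes the
  -- gap.
  have := Submodule.eq_of_le_of_finrank_le h3 (by omega)
  rw [← this] at hh
  exact hh

end Genus

/-! ### The cell structure of the sphere given by a connected diagram -/

theorem sum_ite_fst_eq {ι κ : Type*} [Fintype ι] [Fintype κ] [DecidableEq ι] {M : Type*}
    [AddCommMonoid M] (h : ι × κ → M) (w : ι) :
    ∑ e, (if e.1 = w then h e else 0) = ∑ i, h (w, i) := by
  rw [Fintype.sum_prod_type, Finset.sum_eq_single w]
  · simp
  · intro b _ hb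
    simp [hb]
  · simp

namespace SolidTorusDiagram

variable {n : ℕ} (D : SolidTorusDiagram n)

/-- The region that contains the corner of the crossing `e.1` between the ends `e.2` and
`e.2 + 1`. -/
def cornerRegion (e : Fin n × Fin 4) : Fin D.numRegions := D.region (Sum.inl e)

theorem cornerRegion_join_succ (c : Fin n) (i : Fin 4) :
    D.cornerRegion (D.join (c, i + 1)) = D.cornerRegion (c, i) := D.region_corner c i

theorem join_involutive : Function.Involutive D.join := D.join_join

variable {D}

theorem nonempty_dart (D : SolidTorusDiagram n) : Nonempty D.Dart :=
  ⟨(D.region_surjective D.dot).choose⟩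

theorem Connected.numRegions_eq (hconn : D.Connected) : D.numRegions = n + 2 := by
  have : Subsingleton D.Piece := ⟨fun a b => by
    induction a using Quot.ind
    induction b using Quot.ind
    exact hconn _ _⟩
  have : Nonempty D.Piece := D.nonempty_dart.map D.piece
  have h := D.euler
  rwa [Nat.card_unique] at h

theorem Connected.eq_of_touch {α : Type*} (hconn : D.Connected) {f : D.Dart → α}
    (hf : ∀ d e, D.Touch d e → f d = f e) (d e : D.Dart) : f d = f e :=
  congrArg (Quot.lift f hf) (hconn d e)

theorem Connected.eq_of_invariant {α : Type*} (hconn : D.Connected) {f : Fin n × Fin 4 → α}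
    (hj : ∀ e, f (D.join e) = f e) (hv : ∀ c i, f (c, i + 1) = f (c, i)) (a b : Fin n × Fin 4) :
    f a = f b := by
  -- The value on crossingless loops is immaterial: no touch relates a loop to an arc.
  refine hconn.eq_of_touch (f := Sum.elim f fun _ => f a) ?_ (Sum.inl a) (Sum.inl b)
  rintro _ _ (⟨e | ⟨l, x⟩⟩ | ⟨c, i⟩)
  · exact (hj e).symm
  · rfl
  · exact (hv c i).symm

theorem Connected.isEmpty_loops (hconn : D.Connected) (hn : 0 < n) : IsEmpty (Fin D.numLoops) := by
  refine ⟨fun l => ?_⟩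
  have := hconn.eq_of_touch (f := Sum.isLeft)
    (by rintro _ _ (⟨e | ⟨l, x⟩⟩ | ⟨c, i⟩) <;> rfl) (Sum.inl (⟨0, hn⟩, 0)) (Sum.inr (l, true))
  simp at this

theorem Connected.cornerRegion_surjective (hconn : D.Connected) (hn : 0 < n) :
    Function.Surjective D.cornerRegion := by
  intro r
  have := hconn.isEmpty_loops hn
  obtain ⟨e | ⟨l, x⟩, he⟩ := D.region_surjective r
  · exact ⟨e, he⟩
  · exact isEmptyElim l

/-- A labelling of the corners by faces that is constant along the boundary of each face. -/
def IsFaceMap (D : SolidTorusDiagram n) {Φ : Type*} (reg : Fin n × Fin 4 → Φ) : Prop :=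
  ∀ c i, reg (D.join (c, i + 1)) = reg (c, i)

theorem isFaceMap_cornerRegion (D : SolidTorusDiagram n) : D.IsFaceMap D.cornerRegion :=
  D.cornerRegion_join_succ

section IsFaceMap

variable {Φ : Type*} {reg : Fin n × Fin 4 → Φ}

theorem IsFaceMap.join_eq (hreg : D.IsFaceMap reg) (c : Fin n) (i : Fin 4) :
    reg (D.join (c, i)) = reg (c, i + 3) := by
  rw [← hreg c (i + 3), add_assoc]
  -- In `Fin 4` the sum `3 + 1` reduces to `0`.
  exact congrArg (fun j => reg (D.join (c, j))) (add_zero i).symm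

theorem IsFaceMap.eq_of_step (hreg : D.IsFaceMap reg) (x y : Fin n × Fin 4)
    (h : D.join (x.1, x.2 + 1) = y) : reg x = reg y :=
  h ▸ (hreg x.1 x.2).symm

theorem IsFaceMap.faceCoboundary_apply (hreg : D.IsFaceMap reg) (f : Φ → ZMod 2) (c : Fin n)
    (i : Fin 4) :
    faceCoboundary D.join reg f (c, i) = f (reg (c, i)) + f (reg (c, i + 3)) := by
  rw [← hreg.join_eq]
  rfl

theorem IsFaceMap.faceCoboundary_join (f : Φ → ZMod 2) (e : Fin n × Fin 4) :
    faceCoboundary D.join reg f (D.join e) = faceCoboundary D.join reg f e := by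
  simp [faceCoboundary, D.join_join, add_comm]

theorem IsFaceMap.eq_of_faceCoboundary_eq_zero (hreg : D.IsFaceMap reg) (hconn : D.Connected)
    (hsurj : Function.Surjective reg) {f : Φ → ZMod 2}
    (hf : faceCoboundary D.join reg f = 0) (a b : Φ) : f a = f b := by
  have h : ∀ e, f (reg (D.join e)) = f (reg e) := fun e =>
    (CharTwo.add_eq_zero.1 (congrFun hf e)).symm
  obtain ⟨a, rfl⟩ := hsurj a
  obtain ⟨b, rfl⟩ := hsurj b
  refine hconn.eq_of_invariant (f := fun e => f (reg e)) h (fun c i => ?_) a b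
  rw [← hreg c i, h]

/-- Going once around a crossing meets every corner twice, so the jumps cancel modulo two. -/
theorem IsFaceMap.faceCoboundary_mem_cycleSpace (hreg : D.IsFaceMap reg) (f : Φ → ZMod 2) :
    faceCoboundary D.join reg f ∈ cycleSpace D.join Prod.fst := by
  refine ⟨IsFaceMap.faceCoboundary_join f, fun w => ?_⟩
  rw [sum_ite_fst_eq]
  simp only [hreg.faceCoboundary_apply]
  rw [Finset.sum_add_distrib, CharTwo.add_eq_zero]
  exact (Equiv.sum_comp (Equiv.addRight (3 : Fin 4)) fun i => f (reg (w, i))).symm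

theorem Connected.eq_of_crossing_invariant (hconn : D.Connected) {α : Type*} {g : Fin n → α}
    (hg : ∀ e, g (D.join e).1 = g e.1) (a b : Fin n) : g a = g b :=
  hconn.eq_of_invariant (f := fun e => g e.1) hg (fun _ _ => rfl) (a, 0) (b, 0)

/-- The genus inequality with `n` vertices and `4 * n` darts. It is needed for labellings that may
be finer than the given regions. -/
theorem IsFaceMap.card_le [Fintype Φ] (hreg : D.IsFaceMap reg) (hconn : D.Connected)
    (hsurj : Function.Surjective reg) : Fintype.card Φ ≤ n + 2 := by
  have := two_mul_card_faces_add_le D.join_involutive D.join_ne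
    (Prod.fst_surjective (α := Fin n) (β := Fin 4))
    (fun g hg => hconn.eq_of_crossing_invariant hg)
    (fun f => hreg.eq_of_faceCoboundary_eq_zero hconn hsurj) hreg.faceCoboundary_mem_cycleSpace
  simp only [Fintype.card_prod, Fintype.card_fin] at this
  omega

end IsFaceMap

/-- Every cycle modulo two of edges is the boundary of a set of regions. -/
theorem Connected.exists_faceCoboundary_eq (hconn : D.Connected) (hn : 0 < n)
    {h : Fin n × Fin 4 → ZMod 2} (hh : h ∈ cycleSpace D.join Prod.fst) :
    ∃ f, faceCoboundary D.join D.cornerRegion f = h := by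
  refine _root_.exists_faceCoboundary_eq D.join_involutive D.join_ne
    (Prod.fst_surjective (α := Fin n) (β := Fin 4))
    (fun g hg => hconn.eq_of_crossing_invariant hg)
    (fun f => D.isFaceMap_cornerRegion.eq_of_faceCoboundary_eq_zero hconn
      (hconn.cornerRegion_surjective hn)) D.isFaceMap_cornerRegion.faceCoboundary_mem_cycleSpace
    ?_ hh
  simp only [Fintype.card_prod, Fintype.card_fin, hconn.numRegions_eq]
  omega

/-- The boundary of each region is a single closed path: what is constant along the boundary paths
of the regions depends on the region only. -/
theorem Connected.eq_of_cornerRegion_eq (hconn : D.Connected) {α : Type*}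
    {f : Fin n × Fin 4 → α} (hf : D.IsFaceMap f) {a b : Fin n × Fin 4}
    (hab : D.cornerRegion a = D.cornerRegion b) : f a = f b := by
  classical
  let r : Fin n × Fin 4 → Fin n × Fin 4 → Prop := fun x y => D.join (x.1, x.2 + 1) = y
  have := Fintype.ofFinite (Quot r)
  have hmk : D.IsFaceMap (Quot.mk r) := fun c i =>
    (Quot.sound (r := r) (a := (c, i)) rfl).symm
  have hsurj : Function.Surjective (Quot.lift D.cornerRegion D.isFaceMap_cornerRegion.eq_of_step) := by
    intro y
    obtain ⟨x, hx⟩ := hconn.cornerRegion_surjective a.1.pos y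
    exact ⟨Quot.mk r x, hx⟩
  have hcard := hmk.card_le hconn Quot.mk_surjective
  -- The boundary paths map onto the `n + 2` regions and number at most `n + 2`, so each region has
  -- exactly one.
  have hinj := ((Fintype.bijective_iff_surjective_and_card _).2 ⟨hsurj, le_antisymm
    (by simpa [hconn.numRegions_eq] using hcard) (Fintype.card_le_of_surjective _ hsurj)⟩).1
  exact congrArg (Quot.lift f hf.eq_of_step) (hinj (a₁ := Quot.mk r a) (a₂ := Quot.mk r b) hab)

/-! ### Curves through a crossing -/

/-- The vertex at which an end lies after the crossing `c` has been split along a curve through its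
corners `p` and `p + 2`. -/
def splitVertex (c : Fin n) (p : Fin 4) (e : Fin n × Fin 4) : Option (Fin n) :=
  if e.1 = c ∧ (e.2 = p + 1 ∨ e.2 = p + 2) then none else some e.1

theorem splitVertex_of_ne {c c' : Fin n} (p i : Fin 4) (h : c' ≠ c) :
    splitVertex c p (c', i) = some c' := by
  simp [splitVertex, h]

theorem splitVertex_self (c : Fin n) (p : Fin 4) :
    splitVertex c p (c, p) = some c ∧ splitVertex c p (c, p + 1) = none ∧
      splitVertex c p (c, p + 2) = none ∧ splitVertex c p (c, p + 3) = some c := by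
  simp only [splitVertex, true_and]
  fin_cases p <;> exact ⟨rfl, rfl, rfl, rfl⟩

theorem splitVertex_surjective (c : Fin n) (p : Fin 4) : Function.Surjective (splitVertex c p) := by
  rintro (_ | w)
  · exact ⟨_, (splitVertex_self c p).2.1⟩
  · by_cases h : w = c
    · subst h
      exact ⟨_, (splitVertex_self w p).1⟩
    · exact ⟨(w, 0), splitVertex_of_ne p 0 h⟩

theorem sum_fin_four_rotate {M : Type*} [AddCommMonoid M] (h : Fin 4 → M) (p : Fin 4) :
    ∑ i, h i = h p + h (p + 1) + h (p + 2) + h (p + 3) := by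
  rw [← Equiv.sum_comp (Equiv.addLeft p) h, Fin.sum_univ_four]
  simp

theorem sum_splitVertex {M : Type*} [AddCommMonoid M] (h : Fin n × Fin 4 → M) (c : Fin n)
    (p : Fin 4) (w : Option (Fin n)) :
    ∑ e, (if splitVertex c p e = w then h e else 0) =
      w.elim (h (c, p + 1) + h (c, p + 2))
        fun c' => if c' = c then h (c, p) + h (c, p + 3) else ∑ i, h (c', i) := by
  obtain ⟨h0, h1, h2, h3⟩ := splitVertex_self c p
  rw [Fintype.sum_prod_type]
  rcases w with _ | w
  · rw [Finset.sum_eq_single c, sum_fin_four_rotate _ p]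
    · simp [h0, h1, h2, h3]
    · intro b _ hb
      simp [splitVertex_of_ne p _ hb]
    · simp
  · rw [Finset.sum_eq_single w]
    · by_cases hw : w = c
      · subst hw
        rw [sum_fin_four_rotate _ p]
        simp [h0, h1, h2, h3]
      · simp [splitVertex_of_ne p _ hw, hw]
    · intro b _ hb
      refine Finset.sum_eq_zero fun i _ => if_neg ?_
      unfold splitVertex
      split_ifs
      · simp
      · simpa using hb
    · simp

/-- A combinatorial Jordan curve theorem. If splitting `c` left the graph connected, there would be
`n + 1` vertices, `2 * n` edges and `n + 2` faces, contradicting the genus inequality. -/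
theorem Connected.exists_split_side (hconn : D.Connected) {c : Fin n} {p : Fin 4}
    (hR : D.cornerRegion (c, p + 2) = D.cornerRegion (c, p)) :
    ∃ g : Option (Fin n) → ZMod 2,
      (∀ e, g (splitVertex c p (D.join e)) = g (splitVertex c p e)) ∧ g none ≠ g (some c) := by
  by_contra! hno
  obtain ⟨h0, h1, h2, h3⟩ := splitVertex_self c p
  have hreg := D.isFaceMap_cornerRegion
  have := two_mul_card_faces_add_le (reg := D.cornerRegion) D.join_involutive D.join_ne
    (splitVertex_surjective c p) ?_ (fun f => hreg.eq_of_faceCoboundary_eq_zero hconn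
      (hconn.cornerRegion_surjective c.pos)) ?_
  · simp only [Fintype.card_prod, Fintype.card_fin, hconn.numRegions_eq, Fintype.card_option] at this
    omega
  · intro g hg
    have hc := hno g hg
    have key : ∀ e, g (splitVertex c p e) = g (some e.1) := fun e => by
      unfold splitVertex
      split_ifs with h
      · rw [hc, h.1]
      · rfl
    have hsome : ∀ a b : Fin n, g (some a) = g (some b) :=
      hconn.eq_of_crossing_invariant (g := fun a => g (some a)) fun e => by
        rw [← key, ← key, hg]
    rintro (_ | a) (_ | b)
    · rfl
    · rw [hc]; exact hsome _ _
    · rw [hc]; exact hsome _ _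
    · exact hsome _ _
  · intro f
    refine ⟨IsFaceMap.faceCoboundary_join f, fun w => ?_⟩
    have e1 : p + 1 + 3 = p := (add_assoc p 1 3).trans (add_zero p)
    have e2 : p + 2 + 3 = p + 1 := add_assoc p 2 3
    have e3 : p + 3 + 3 = p + 2 := add_assoc p 3 3
    rw [sum_splitVertex]
    -- At each half of `c` the jumps cancel only because the corners `p` and `p + 2` belong to the
    -- same region.
    rcases w with _ | w
    · simp only [Option.elim_none, hreg.faceCoboundary_apply, e1, e2, hR]
      rw [add_comm (f (D.cornerRegion (c, p))), CharTwo.add_self_eq_zero]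
    · simp only [Option.elim_some]
      split_ifs with h
      · simp only [hreg.faceCoboundary_apply, e3, hR]
        rw [add_comm (f (D.cornerRegion (c, p))), CharTwo.add_self_eq_zero]
      · rw [← sum_ite_fst_eq]
        exact (hreg.faceCoboundary_mem_cycleSpace f).2 w

theorem Connected.exists_curveThrough (hconn : D.Connected) {c : Fin n} {p : Fin 4}
    (hR : D.cornerRegion (c, p + 2) = D.cornerRegion (c, p)) :
    ∃ γ : D.CurveThrough c, γ.corner = p := by
  obtain ⟨g, hg, hne⟩ := hconn.exists_split_side hR
  have := hconn.isEmpty_loops c.pos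
  obtain ⟨h0, h1, h2, h3⟩ := splitVertex_self c p
  let σ : Fin n × Fin 4 → Bool := fun e => decide (g (splitVertex c p e) = g none)
  -- Masking the region of the curve leaves a label that is constant along the boundary of every
  -- other region. Since that boundary is a single path, each of these regions lies on one side.
  have hσ : D.IsFaceMap fun e =>
      if D.cornerRegion e = D.cornerRegion (c, p) then none else some (σ e) := by
    intro c' i
    simp only [D.cornerRegion_join_succ]
    split_ifs with h
    · rfl
    · simp only [σ, hg]
      congr 3
      by_cases hc : c' = c
      · subst hc
        obtain ⟨j, rfl⟩ : ∃ j, i = p + j := ⟨i - p, by simp⟩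
        have e2 : p + 1 + 1 = p + 2 := add_assoc p 1 1
        have e3 : p + 3 + 1 = p := (add_assoc p 3 1).trans (add_zero p)
        -- The corners `p` and `p + 2` are masked; each of the other two has both its ends on the
        -- same half of `c`.
        fin_cases j
        · simp at h
        · simp [e2, h1, h2]
        · exact absurd hR h
        · simp [e3, h0, h3]
      · rw [splitVertex_of_ne p _ hc, splitVertex_of_ne p _ hc]
  have hreg : ∀ a b, D.cornerRegion a = D.cornerRegion b →
      D.cornerRegion a ≠ D.cornerRegion (c, p) → σ a = σ b := by
    intro a b hab ha
    have := hconn.eq_of_cornerRegion_eq hσ hab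
    simpa [ha, hab ▸ ha] using this
  -- These corners fix the sides of the dot and the outer boundary. If one of the two lies in the
  -- region of the curve, its side is unconstrained.
  obtain ⟨ed, hed⟩ := hconn.cornerRegion_surjective c.pos D.dot
  obtain ⟨eo, heo⟩ := hconn.cornerRegion_surjective c.pos D.outer
  refine ⟨{ corner := p
            same_region := hR
            side := Sum.elim σ fun _ => true
            side_flip := ?_
            side_vertex := ?_
            side_left := ?_
            side_right := ?_
            side_ne := ?_
            side_region := ?_
            dotSide := σ ed
            outerSide := σ eo
            side_dot := ?_
            side_outer := ?_ }, rfl⟩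
  · rintro (e | ⟨l, x⟩)
    · simp [PDCode.flip, σ, hg]
    · exact isEmptyElim l
  · intro c' i hc
    simp [σ, splitVertex_of_ne p _ hc]
  · simp [σ, h1, h2]
  · simp [σ, h0, h3]
  · simp [σ, h0, h1, hne.symm]
  · rintro (e | ⟨l, x⟩) (e' | ⟨l', x'⟩)
    · exact hreg e e'
    · exact isEmptyElim l'
    · exact isEmptyElim l
    · exact isEmptyElim l
  · rintro (e | ⟨l, x⟩) h h'
    · exact hreg e ed (h.trans hed.symm) h'
    · exact isEmptyElim l
  · rintro (e | ⟨l, x⟩) h h'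
    · exact hreg e eo (h.trans heo.symm) h'
    · exact isEmptyElim l

/-- In a dotted-reduced diagram, a curve through a crossing separates the dot from the outer
boundary, and neither of them lies in the region in which the curve runs. -/
theorem DottedReduced.curveThrough (hred : D.DottedReduced) {c : Fin n} (γ : D.CurveThrough c) :
    γ.dotSide ≠ γ.outerSide ∧ D.dot ≠ D.cornerRegion (c, γ.corner) ∧
      D.outer ≠ D.cornerRegion (c, γ.corner) := by
  have hno := (hred c ⟨γ⟩).2
  -- If the dot or the outer boundary lay in the region of the curve, the curve could be rerouted
  -- past it, which would make it contractible.
  refine ⟨fun h => hno ⟨γ, h⟩, fun h => hno ⟨{ γ with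
    dotSide := γ.outerSide
    side_dot := fun d hd hd' => absurd (hd.trans h) hd' }, rfl⟩, fun h => hno ⟨{ γ with
    outerSide := γ.dotSide
    side_outer := fun d hd hd' => absurd (hd.trans h) hd' }, rfl⟩⟩

end SolidTorusDiagram

/-! ### Smoothings -/

/-- A smoothing `x` connects the ends on the two sides of the corners `x.corner` and
`x.corner + 2`. -/
def Smoothing.corner : Smoothing → Fin 4
  | .A => 0
  | .B => 1

namespace Smoothing

theorem partner_partner (x : Smoothing) (i : Fin 4) : x.partner (x.partner i) = i := by
  cases x <;> fin_cases i <;> rfl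

theorem partner_ne (x : Smoothing) (i : Fin 4) : x.partner i ≠ i := by
  cases x <;> fin_cases i <;> decide

theorem partner_corner (x : Smoothing) : x.partner x.corner = x.corner + 1 := by
  cases x <;> rfl

theorem partner_corner_add_two (x : Smoothing) :
    x.partner (x.corner + 2) = x.corner + 3 := by
  cases x <;> rfl

theorem partner_corner_of_ne {x y : Smoothing} (h : y ≠ x) :
    y.partner x.corner = x.corner + 3 := by
  cases x <;> cases y <;> first | rfl | exact absurd rfl h

theorem partner_corner_add_one_of_ne {x y : Smoothing} (h : y ≠ x) :
    y.partner (x.corner + 1) = x.corner + 2 := by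
  cases x <;> cases y <;> first | rfl | exact absurd rfl h

theorem isOver_partner (x : Smoothing) (i : Fin 4) : isOver (x.partner i) = !isOver i := by
  cases x <;> fin_cases i <;> rfl

theorem partner_of_isOver_eq {x : Smoothing} {i : Fin 4} (h : isOver i = isOver x.corner) :
    x.partner i = i + 1 := by
  cases x <;> fin_cases i <;> first | rfl | simp [isOver, corner] at h

theorem partner_zero_or_two (x : Smoothing) (i : Fin 4) :
    (i = 0 ∨ i = x.partner 0) ∨ (i = 2 ∨ i = x.partner 2) := by
  cases x <;> fin_cases i <;> simp [partner]

end Smoothing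

theorem isOver_add_one (i : Fin 4) : isOver (i + 1) = !isOver i := by
  fin_cases i <;> rfl

/-! ### Counting circles -/

/-- Since `glue` moves only `q`, the map `π'` separates all classes other than `q`; the class `q`
itself accounts for the extra element. -/
theorem Nat.card_le_card_add_one_of_glue {α Q Q' : Type*} [Finite Q'] {π : α → Q} {π' : α → Q'}
    (hπ : Function.Surjective π) (q : Q) (glue : Q → Q) (hglue : ∀ z, z ≠ q → glue z = z)
    (h : ∀ x y, π' x = π' y → glue (π x) = glue (π y)) :
    Nat.card Q ≤ Nat.card Q' + 1 := by
  classical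
  let j : Q → Option Q' := fun z => if z = q then none else some (π' (hπ z).choose)
  have hj : Function.Injective j := by
    intro z w hzw
    by_cases hz : z = q <;> by_cases hw : w = q
    · rw [hz, hw]
    · simp [j, hz, hw] at hzw
    · simp [j, hz, hw] at hzw
    · simp only [j, hz, hw, if_false, Option.some.injEq] at hzw
      have := h _ _ hzw
      rwa [(hπ z).choose_spec, (hπ w).choose_spec, hglue z hz, hglue w hw] at this
  exact (Nat.card_le_card_of_injective j hj).trans (Finite.card_option).le

namespace SolidTorusDiagram

variable {n : ℕ} {D : SolidTorusDiagram n}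

instance (s : Fin n → Smoothing) : Finite (D.StateCircle s) := by
  unfold StateCircle
  infer_instance

theorem stateCircle_surjective (s : Fin n → Smoothing) : Function.Surjective (D.stateCircle s) :=
  Quot.mk_surjective

theorem stateCircle_flip (s : Fin n → Smoothing) (d : D.Dart) :
    D.stateCircle s (D.flip d) = D.stateCircle s d :=
  (Quot.sound (StateTouch.edge d)).symm

theorem stateCircle_join (s : Fin n → Smoothing) (e : Fin n × Fin 4) :
    D.stateCircle s (Sum.inl (D.join e)) = D.stateCircle s (Sum.inl e) :=
  stateCircle_flip s (Sum.inl e)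

theorem stateCircle_partner (s : Fin n → Smoothing) (c : Fin n) (i : Fin 4) :
    D.stateCircle s (Sum.inl (c, (s c).partner i)) = D.stateCircle s (Sum.inl (c, i)) :=
  (Quot.sound (StateTouch.smooth c i)).symm

theorem one_le_numCircles (D : SolidTorusDiagram n) (s : Fin n → Smoothing) :
    1 ≤ D.numCircles s := by
  have : Nonempty (D.StateCircle s) := D.nonempty_dart.map (D.stateCircle s)
  exact Nat.card_pos

/-- What is invariant under the moves of a state is determined by the circle. -/
theorem eq_of_stateCircle_eq {α : Type*} {s : Fin n → Smoothing} {f : D.Dart → α}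
    (hflip : ∀ d, f (D.flip d) = f d)
    (hsmooth : ∀ c i, f (Sum.inl (c, (s c).partner i)) = f (Sum.inl (c, i))) {d e : D.Dart}
    (h : D.stateCircle s d = D.stateCircle s e) : f d = f e := by
  refine congrArg (Quot.lift f ?_) h
  rintro d _ (_ | ⟨c, i⟩)
  · exact (hflip d).symm
  · exact (hsmooth c i).symm

/-- Both states are compared with the quotient `Quot r` imposing the relations of both: `s` maps
onto it, and passing to it from `s'` merges at most the two circles through `c`. -/
theorem numCircles_update_le (s : Fin n → Smoothing) (c : Fin n) (y : Smoothing) :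
    D.numCircles (Function.update s c y) ≤ D.numCircles s + 1 := by
  classical
  set s' := Function.update s c y with hs'
  let r : D.Dart → D.Dart → Prop := fun d e => D.StateTouch s d e ∨ D.StateTouch s' d e
  have h1 : Nat.card (Quot r) ≤ D.numCircles s :=
    Nat.card_le_card_of_surjective
      (Quot.lift (Quot.mk r) fun d e h => Quot.sound (Or.inl h) : D.StateCircle s → Quot r) (by
        rintro ⟨d⟩
        exact ⟨D.stateCircle s d, rfl⟩)
  let q := D.stateCircle s' (Sum.inl (c, 0))
  let glue : D.StateCircle s' → D.StateCircle s' := fun z =>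
    if z = q then D.stateCircle s' (Sum.inl (c, 2)) else z
  have hc : ∀ i, glue (D.stateCircle s' (Sum.inl (c, i))) = D.stateCircle s' (Sum.inl (c, 2)) := by
    intro i
    rcases (s' c).partner_zero_or_two i with (rfl | rfl) | (rfl | rfl)
    · simp [glue, q]
    · simp [glue, q, stateCircle_partner]
    · simp [glue]
    · simp [glue, stateCircle_partner]
  have h2 : D.numCircles s' ≤ Nat.card (Quot r) + 1 := by
    refine Nat.card_le_card_add_one_of_glue (π' := Quot.mk r) (stateCircle_surjective s') q glue
      (fun z hz => if_neg hz) ?_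
    intro d e hde
    refine congrArg (Quot.lift (fun d => glue (D.stateCircle s' d)) ?_) hde
    rintro d _ ((_ | ⟨c', i⟩) | (_ | ⟨c', i⟩))
    · exact congrArg glue (stateCircle_flip s' d).symm
    · by_cases h : c' = c
      · subst h
        rw [hc, hc]
      · have : s c' = s' c' := by simp [hs', h]
        rw [this, stateCircle_partner]
    · exact congrArg glue (stateCircle_flip s' d).symm
    · exact congrArg glue (stateCircle_partner s' c' i).symm
  omega

theorem numCircles_le_add_card (s s' : Fin n → Smoothing) :
    D.numCircles s' ≤ D.numCircles s + (Finset.univ.filter fun c => s' c ≠ s c).card := by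
  induction hk : (Finset.univ.filter fun c => s' c ≠ s c).card generalizing s with
  | zero =>
    rw [Finset.card_eq_zero, Finset.filter_eq_empty_iff] at hk
    have : s' = s := funext fun c => by simpa using hk (Finset.mem_univ c)
    simp [this]
  | succ k ih =>
    obtain ⟨c, hc⟩ : (Finset.univ.filter fun c => s' c ≠ s c).Nonempty :=
      Finset.card_pos.1 (by omega)
    have hcard : (Finset.univ.filter fun c' => s' c' ≠ Function.update s c (s' c) c').card = k := by
      have : (Finset.univ.filter fun c' => s' c' ≠ Function.update s c (s' c) c')
          = (Finset.univ.filter fun c' => s' c' ≠ s c').erase c := by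
        ext c'
        by_cases h : c' = c
        · subst h; simp
        · simp [h]
      rw [this, Finset.card_erase_of_mem hc, hk, Nat.add_sub_cancel]
    have := ih _ hcard
    have := D.numCircles_update_le s c (s' c)
    omega

/-- If a smoothing joins two different circles, then each of them is cut open at one place, and so
the ends of the resulting arc stay connected. -/
theorem stateCircle_update_eq {s : Fin n → Smoothing} {c : Fin n} {y : Smoothing}
    (hy : y ≠ s c)
    (hne : D.stateCircle s (Sum.inl (c, (s c).corner + 2))
      ≠ D.stateCircle s (Sum.inl (c, (s c).corner))) :
    D.stateCircle (Function.update s c y) (Sum.inl (c, (s c).corner + 1))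
      = D.stateCircle (Function.update s c y) (Sum.inl (c, (s c).corner)) := by
  classical
  by_contra hcon
  set s' := Function.update s c y with hs'
  set p := (s c).corner with hp
  -- A parity argument: `L` has even size because arcs pair its elements. By `hcon` and `hne` its
  -- only end at `c` is `p`, and the smoothings pair all the others, so its size is also odd.
  let L : Finset (Fin n × Fin 4) := Finset.univ.filter fun e =>
    D.stateCircle s (Sum.inl e) = D.stateCircle s (Sum.inl (c, p)) ∧
      D.stateCircle s' (Sum.inl e) = D.stateCircle s' (Sum.inl (c, p))
  have hpL : (c, p) ∈ L := by simp [L]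
  have h1 : ∑ e ∈ L, (1 : ZMod 2) = 0 := by
    refine Finset.sum_involution (fun e _ => D.join e) (fun _ _ => by decide)
      (fun e _ _ => D.join_ne e) (fun e he => ?_) (fun e _ => D.join_join e)
    simpa [L, stateCircle_join] using he
  have hLc : ∀ i, (c, i) ∈ L → i = p := by
    intro i hi
    obtain ⟨hi1, hi2⟩ := (Finset.mem_filter.1 hi).2
    obtain ⟨j, rfl⟩ : ∃ j, i = p + j := ⟨i - p, by simp⟩
    have h3 := stateCircle_partner (D := D) s c (p + 2)
    rw [hp, Smoothing.partner_corner_add_two, ← hp] at h3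
    fin_cases j
    · simp
    · exact absurd hi2 hcon
    · exact absurd hi1 hne
    · exact absurd (h3.symm.trans hi1) hne
  have h2 : ∑ e ∈ L.erase (c, p), (1 : ZMod 2) = 0 := by
    refine Finset.sum_involution (fun e _ => (e.1, (s e.1).partner e.2)) (fun _ _ => by decide)
      (fun e _ _ h => (s e.1).partner_ne e.2 (congrArg Prod.snd h)) (fun e he => ?_)
      (fun e _ => by simp [Smoothing.partner_partner])
    obtain ⟨c', i⟩ := e
    rw [Finset.mem_erase] at he
    have hc' : c' ≠ c := by
      rintro rfl
      exact he.1 (by rw [hLc i he.2])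
    have hs : s c' = s' c' := by simp [hs', hc']
    refine Finset.mem_erase.2 ⟨fun h => hc' (congrArg Prod.fst h), ?_⟩
    have := he.2
    simp only [L, Finset.mem_filter, Finset.mem_univ, true_and] at this ⊢
    refine ⟨(stateCircle_partner s c' i).trans this.1, ?_⟩
    rw [hs]
    exact (stateCircle_partner s' c' i).trans this.2
  rw [← Finset.add_sum_erase _ _ hpL, h2] at h1
  exact absurd h1 (by decide)

/-- After the change all four ends of `c` lie on one circle. The old circles thus map onto the new
ones, and the two different ones at `c` get the same image. -/
theorem numCircles_update_lt {s : Fin n → Smoothing} {c : Fin n} {y : Smoothing}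
    (hy : y ≠ s c)
    (hne : D.stateCircle s (Sum.inl (c, (s c).corner + 2))
      ≠ D.stateCircle s (Sum.inl (c, (s c).corner))) :
    D.numCircles (Function.update s c y) < D.numCircles s := by
  have h1 := stateCircle_update_eq hy hne
  set s' := Function.update s c y with hs'
  set p := (s c).corner with hp
  have hc : s' c = y := by simp [hs']
  have h3 := stateCircle_partner (D := D) s' c p
  have h2 := stateCircle_partner (D := D) s' c (p + 1)
  rw [hc, hp, Smoothing.partner_corner_of_ne hy, ← hp] at h3
  rw [hc, hp, Smoothing.partner_corner_add_one_of_ne hy, ← hp] at h2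
  have hall : ∀ i, D.stateCircle s' (Sum.inl (c, i)) = D.stateCircle s' (Sum.inl (c, p)) := by
    intro i
    obtain ⟨j, rfl⟩ : ∃ j, i = p + j := ⟨i - p, by simp⟩
    fin_cases j
    · simp
    · exact h1
    · exact h2.trans h1
    · exact h3
  have hmap : ∀ d e, D.StateTouch s d e → D.stateCircle s' d = D.stateCircle s' e := by
    rintro d _ (_ | ⟨c', i⟩)
    · exact (stateCircle_flip s' d).symm
    · by_cases h : c' = c
      · subst h
        exact (hall i).trans (hall _).symm
      · have : s c' = s' c' := by simp [hs', h]
        rw [this, stateCircle_partner]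
  let φ : D.StateCircle s → D.StateCircle s' := Quot.lift (D.stateCircle s') hmap
  have hφ : Function.Surjective φ := by
    rintro ⟨d⟩
    exact ⟨D.stateCircle s d, rfl⟩
  refine lt_of_le_of_ne (Nat.card_le_card_of_surjective φ hφ) fun h => hne ?_
  have hbij := (Nat.bijective_iff_surjective_and_card φ).2 ⟨hφ, h.symm⟩
  exact hbij.1 (hall (p + 2))

/-! ### The extreme states of an alternating diagram -/

theorem Alternating.isOver_join (halt : D.Alternating) (e : Fin n × Fin 4) :
    isOver (D.join e).2 = !isOver e.2 := by
  have := halt e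
  revert this
  cases isOver (D.join e).2 <;> cases isOver e.2 <;> simp

/-- This is the checkerboard colouring: both passing to the next end and following an arc exchange
over and under. -/
theorem Alternating.isFaceMap_isOver (halt : D.Alternating) : D.IsFaceMap fun e => isOver e.2 :=
  fun c i => by simp only [halt.isOver_join, isOver_add_one, Bool.not_not]

variable (D) in
/-- Of the two regions next to an edge of an alternating diagram, the one whose corners are cut off
by the smoothing `x`. -/
def smoothedRegion (x : Smoothing) (e : Fin n × Fin 4) : Fin D.numRegions :=
  if isOver e.2 = isOver x.corner then D.cornerRegion e else D.cornerRegion (D.join e)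

theorem Alternating.smoothedRegion_join (halt : D.Alternating) (x : Smoothing)
    (e : Fin n × Fin 4) : D.smoothedRegion x (D.join e) = D.smoothedRegion x e := by
  have := halt.isOver_join e
  unfold smoothedRegion
  rw [this, D.join_join]
  cases isOver e.2 <;> cases isOver x.corner <;> simp

/-- The ends joined by `x` flank a corner cut off by `x`, and that corner's region is the smoothed
region of both. -/
theorem smoothedRegion_partner (x : Smoothing) (c : Fin n) (i : Fin 4) :
    D.smoothedRegion x (c, x.partner i) = D.smoothedRegion x (c, i) := by
  have key : ∀ i, isOver i = isOver x.corner →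
      D.smoothedRegion x (c, x.partner i) = D.smoothedRegion x (c, i) := by
    intro i hi
    have h1 : isOver (x.partner i) ≠ isOver x.corner := by
      rw [x.isOver_partner, hi]; simp
    simp only [smoothedRegion, hi, h1, if_true, if_false]
    rw [Smoothing.partner_of_isOver_eq hi, D.cornerRegion_join_succ]
  by_cases hi : isOver i = isOver x.corner
  · exact key i hi
  · have := key (x.partner i) (by
      rw [x.isOver_partner]; revert hi; cases isOver i <;> cases isOver x.corner <;> simp)
    rw [x.partner_partner] at this
    exact this.symm

theorem smoothedRegion_corner (x : Smoothing) (c : Fin n) :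
    D.smoothedRegion x (c, x.corner) = D.cornerRegion (c, x.corner) := by
  simp [smoothedRegion]

theorem smoothedRegion_corner_add_two (x : Smoothing) (c : Fin n) :
    D.smoothedRegion x (c, x.corner + 2) = D.cornerRegion (c, x.corner + 2) := by
  cases x <;> simp [smoothedRegion, Smoothing.corner, isOver]

theorem Alternating.exists_rep (halt : D.Alternating) [IsEmpty (Fin D.numLoops)]
    (x : Smoothing) (s : Fin n → Smoothing) (C : D.StateCircle s) :
    ∃ e : Fin n × Fin 4, isOver e.2 = isOver x.corner ∧ D.stateCircle s (Sum.inl e) = C := by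
  obtain ⟨e | ⟨l, b⟩, rfl⟩ := stateCircle_surjective s C
  · by_cases h : isOver e.2 = isOver x.corner
    · exact ⟨e, h, rfl⟩
    · refine ⟨D.join e, ?_, stateCircle_join s e⟩
      rw [halt.isOver_join]
      revert h
      cases isOver e.2 <;> cases isOver x.corner <;> simp
  · exact isEmptyElim l

/-- The circles of the state with only `x`-smoothings are the boundaries of the regions whose
corners are cut off by `x`. -/
theorem Alternating.stateCircle_const_eq_iff (halt : D.Alternating) (hconn : D.Connected)
    (x : Smoothing) (a b : Fin n × Fin 4) :
    D.stateCircle (fun _ => x) (Sum.inl a) = D.stateCircle (fun _ => x) (Sum.inl b) ↔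
      D.smoothedRegion x a = D.smoothedRegion x b := by
  classical
  have := hconn.isEmpty_loops a.1.pos
  constructor
  · intro h
    refine eq_of_stateCircle_eq
      (f := Sum.elim (D.smoothedRegion x) fun l => isEmptyElim l.1) ?_ ?_ h
    · rintro (e | ⟨l, _⟩)
      · exact halt.smoothedRegion_join x e
      · exact isEmptyElim l
    · exact fun c i => smoothedRegion_partner x c i
  -- For the converse, the circle is used as a label on the regions of one colour; it is constant
  -- along their boundary paths.
  · have hface : D.IsFaceMap fun e => if isOver e.2 = isOver x.corner then
        some (D.stateCircle (fun _ => x) (Sum.inl e)) else none := by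
      intro c i
      have h1 := halt.isFaceMap_isOver c i
      simp only at h1
      simp only [h1]
      split_ifs with h
      · have := stateCircle_partner (D := D) (fun _ => x) c i
        rw [Smoothing.partner_of_isOver_eq h] at this
        rw [stateCircle_join, this]
      · rfl
    have main : ∀ a b : Fin n × Fin 4, isOver a.2 = isOver x.corner →
        isOver b.2 = isOver x.corner → D.smoothedRegion x a = D.smoothedRegion x b →
        D.stateCircle (fun _ => x) (Sum.inl a) = D.stateCircle (fun _ => x) (Sum.inl b) := by
      intro a b ha hb hab
      simp only [smoothedRegion, ha, hb, if_true] at hab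
      simpa [ha, hb] using hconn.eq_of_cornerRegion_eq hface hab
    have rep : ∀ a : Fin n × Fin 4, ∃ a', isOver a'.2 = isOver x.corner ∧
        D.smoothedRegion x a' = D.smoothedRegion x a ∧
        D.stateCircle (fun _ => x) (Sum.inl a') = D.stateCircle (fun _ => x) (Sum.inl a) := by
      intro a
      by_cases ha : isOver a.2 = isOver x.corner
      · exact ⟨a, ha, rfl, rfl⟩
      · refine ⟨D.join a, ?_, halt.smoothedRegion_join x a, stateCircle_join _ a⟩
        rw [halt.isOver_join]
        revert ha
        cases isOver a.2 <;> cases isOver x.corner <;> simp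
    intro h
    obtain ⟨a', h1, h2, h3⟩ := rep a
    obtain ⟨b', h4, h5, h6⟩ := rep b
    rw [← h3, ← h6]
    exact main a' b' h1 h4 (by rw [h2, h5, h])

/-- Each of the two states has one circle for every region of one checkerboard colour. -/
theorem Alternating.numCircles_const_add (halt : D.Alternating) (hconn : D.Connected) :
    D.numCircles (fun _ => .A) + D.numCircles (fun _ => .B) = n + 2 := by
  classical
  -- Without crossings the diagram is a single loop, and there are no corners with which to describe
  -- the regions.
  rcases Nat.eq_zero_or_pos n with rfl | hn
  · have h : ∀ s, D.numCircles s = 1 := fun s => by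
      have : Subsingleton (D.StateCircle s) := ⟨fun a b => by
        obtain ⟨a, rfl⟩ := stateCircle_surjective s a
        obtain ⟨b, rfl⟩ := stateCircle_surjective s b
        refine hconn.eq_of_touch ?_ a b
        rintro d _ (_ | ⟨c, i⟩)
        · exact (stateCircle_flip s d).symm
        · exact c.elim0⟩
      have : Nonempty (D.StateCircle s) := D.nonempty_dart.map (D.stateCircle s)
      exact Nat.card_unique
    rw [h, h]
  have := hconn.isEmpty_loops hn
  have hsurj := hconn.cornerRegion_surjective hn
  choose e he using hsurj
  let cls : Fin D.numRegions → Bool := fun r => isOver (e r).2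
  have hcls : ∀ a, cls (D.cornerRegion a) = isOver a.2 := fun a =>
    hconn.eq_of_cornerRegion_eq halt.isFaceMap_isOver (he _)
  have hcount : ∀ x : Smoothing, D.numCircles (fun _ => x)
      = (Finset.univ.filter fun r => cls r = isOver x.corner).card := by
    intro x
    rw [← Fintype.card_subtype, ← Nat.card_eq_fintype_card]
    refine (Nat.card_congr (Equiv.ofBijective
      (fun r : {r // cls r = isOver x.corner} => D.stateCircle (fun _ => x) (Sum.inl (e r.1)))
      ⟨?_, ?_⟩)).symm
    · rintro ⟨r, hr⟩ ⟨r', hr'⟩ h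
      have := (halt.stateCircle_const_eq_iff hconn x _ _).1 h
      simp only [smoothedRegion, cls] at this hr hr'
      rw [if_pos hr, if_pos hr', he, he] at this
      exact Subtype.ext this
    · intro C
      obtain ⟨a, ha, rfl⟩ := halt.exists_rep x _ C
      have hra : cls (D.cornerRegion a) = isOver x.corner := (hcls a).trans ha
      refine ⟨⟨D.cornerRegion a, hra⟩, (halt.stateCircle_const_eq_iff hconn x _ _).2 ?_⟩
      simp only [smoothedRegion, cls] at hra ⊢
      rw [if_pos hra, if_pos ha, he]
  rw [hcount, hcount, ← hconn.numRegions_eq]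
  have hB : (Finset.univ.filter fun r => cls r = isOver Smoothing.B.corner)
      = Finset.univ.filter fun r => ¬ cls r = isOver Smoothing.A.corner := by
    ext r
    rw [Finset.mem_filter, Finset.mem_filter]
    simp [isOver, Smoothing.corner]
  rw [hB, Finset.card_filter_add_card_filter_not]
  simp

end SolidTorusDiagram

theorem ZMod.two_ne_iff_add_eq_one (a b : ZMod 2) : a ≠ b ↔ a + b = 1 := by
  revert a b
  decide

namespace SolidTorusDiagram

variable {n : ℕ} {D : SolidTorusDiagram n}

/-! ### Circles around the dot -/

open Classical in
-- Two-valued sides become functions to `ZMod 2`, so that circles can be added as cycles.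
theorem goesAroundDot_iff [IsEmpty (Fin D.numLoops)] {s : Fin n → Smoothing}
    (C : D.StateCircle s) :
    D.GoesAroundDot C ↔ ∃ f : Fin D.numRegions → ZMod 2,
      (∀ e, faceCoboundary D.join D.cornerRegion f e
        = if D.stateCircle s (Sum.inl e) = C then 1 else 0) ∧ f D.dot ≠ f D.outer := by
  constructor
  · rintro ⟨side, h1, h2⟩
    have inj : Function.Injective fun b : Bool => if b then (1 : ZMod 2) else 0 := by decide
    refine ⟨fun r => if side r then 1 else 0, fun e => ?_, fun h => h2 (inj h)⟩
    have h := h1 (Sum.inl e)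
    change (if side (D.region (Sum.inl e)) then (1 : ZMod 2) else 0)
      + (if side (D.region (D.flip (Sum.inl e))) then 1 else 0) = _
    rw [← if_congr h rfl rfl]
    cases side (D.region (Sum.inl e)) <;> cases side (D.region (D.flip (Sum.inl e))) <;> decide
  · rintro ⟨f, h1, h2⟩
    have key : ∀ a b : ZMod 2, (decide (a = 1) ≠ decide (b = 1)) ↔ a ≠ b := by decide
    refine ⟨fun r => decide (f r = 1), ?_, (key _ _).2 h2⟩
    rintro (e | ⟨l, _⟩)
    · have h := h1 e
      rw [key, ZMod.two_ne_iff_add_eq_one]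
      change faceCoboundary D.join D.cornerRegion f e = 1 ↔ _
      rw [h]
      simp
    · exact isEmptyElim l

open Classical in
/-- Every circle of a state separates the sphere. -/
theorem Connected.exists_bounding (hconn : D.Connected) (hn : 0 < n) {s : Fin n → Smoothing}
    (C : D.StateCircle s) : ∃ f : Fin D.numRegions → ZMod 2,
      ∀ e, faceCoboundary D.join D.cornerRegion f e
        = if D.stateCircle s (Sum.inl e) = C then 1 else 0 := by
  -- The smoothing pairs the ends at each crossing, so a state circle uses an even number of them.
  have hmem : (fun e => if D.stateCircle s (Sum.inl e) = C then (1 : ZMod 2) else 0)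
      ∈ cycleSpace D.join Prod.fst := by
    refine ⟨fun e => by simp only [stateCircle_join], fun w => ?_⟩
    rw [sum_ite_fst_eq]
    refine Finset.sum_involution (fun i _ => (s w).partner i) (fun i _ => ?_)
      (fun i _ _ => (s w).partner_ne i) (fun _ _ => Finset.mem_univ _)
      (fun i _ => (s w).partner_partner i)
    simp only [stateCircle_partner]
    exact CharTwo.add_self_eq_zero _
  obtain ⟨f, hf⟩ := hconn.exists_faceCoboundary_eq hn hmem
  exact ⟨f, congrFun hf⟩

/-- Whether a function separates the dot from the outer boundary therefore depends only on its
coboundary. -/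
theorem Connected.sub_eq_of_faceCoboundary_eq (hconn : D.Connected) (hn : 0 < n)
    {f g : Fin D.numRegions → ZMod 2}
    (h : ∀ e, faceCoboundary D.join D.cornerRegion f e = faceCoboundary D.join D.cornerRegion g e)
    (a b : Fin D.numRegions) : f a - g a = f b - g b := by
  refine D.isFaceMap_cornerRegion.eq_of_faceCoboundary_eq_zero hconn
    (hconn.cornerRegion_surjective hn) (f := f - g) ?_ a b
  rw [map_sub, sub_eq_zero]
  exact funext h

open Classical in
/-- If some circles of a state together separate the dot from the outer boundary, then one of them
does. -/
theorem Connected.exists_goesAroundDot (hconn : D.Connected) (hn : 0 < n)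
    {s : Fin n → Smoothing} (Z : Set (D.StateCircle s)) {f : Fin D.numRegions → ZMod 2}
    (hf : ∀ e, faceCoboundary D.join D.cornerRegion f e
      = if D.stateCircle s (Sum.inl e) ∈ Z then 1 else 0) (hne : f D.dot ≠ f D.outer) :
    ∃ C ∈ Z, D.GoesAroundDot C := by
  have := hconn.isEmpty_loops hn
  have := Fintype.ofFinite (D.StateCircle s)
  by_contra! hno
  choose g hg using fun C : D.StateCircle s => hconn.exists_bounding hn C
  have hgC : ∀ C ∈ Z, g C D.dot = g C D.outer := fun C hC => by
    by_contra h
    exact hno C hC ((goesAroundDot_iff C).2 ⟨g C, hg C, h⟩)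
  -- The sum of functions bounding the single circles has the coboundary of `f`; if no summand
  -- separates the dot from the outer boundary, neither does `f`.
  have hsum : ∀ e, faceCoboundary D.join D.cornerRegion f e
      = faceCoboundary D.join D.cornerRegion (∑ C with C ∈ Z, g C) e := by
    intro e
    rw [hf, map_sum, Finset.sum_apply]
    simp only [hg]
    rw [Finset.sum_ite_eq]
    simp
  have h := hconn.sub_eq_of_faceCoboundary_eq hn hsum D.dot D.outer
  rw [Finset.sum_apply, Finset.sum_apply,
    Finset.sum_congr rfl fun C hC => hgC C (Finset.mem_filter.1 hC).2] at h
  exact hne (sub_left_injective h)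

/-- Regions of opposite checkerboard colours are different; in particular no region lies on both
sides of an edge. -/
theorem cornerRegion_join_ne (halt : D.Alternating) (hconn : D.Connected)
    {a b : Fin n × Fin 4} (h : isOver a.2 = isOver b.2) :
    D.cornerRegion (D.join a) ≠ D.cornerRegion b := by
  intro hab
  have := hconn.eq_of_cornerRegion_eq halt.isFaceMap_isOver hab
  simp only [halt.isOver_join, h] at this
  cases isOver b.2 <;> simp at this

theorem Alternating.forall_of_isOver (halt : D.Alternating) {P : Fin n × Fin 4 → Prop}
    (x : Smoothing) (hP : ∀ e, P (D.join e) → P e) (h : ∀ e, isOver e.2 = isOver x.corner → P e)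
    (e : Fin n × Fin 4) : P e := by
  by_cases he : isOver e.2 = isOver x.corner
  · exact h e he
  · refine hP e (h _ ?_)
    rw [halt.isOver_join]
    revert he
    cases isOver e.2 <;> cases isOver x.corner <;> simp

open Classical in
theorem Alternating.faceCoboundary_single (halt : D.Alternating) (hconn : D.Connected)
    (x : Smoothing) {b : Fin n × Fin 4} (hb : isOver b.2 = isOver x.corner) :
    ∀ e, faceCoboundary D.join D.cornerRegion (fun r => if r = D.cornerRegion b then 1 else 0) e
      = if D.smoothedRegion x e = D.cornerRegion b then 1 else 0 := by
  refine halt.forall_of_isOver x (fun e h => ?_) (fun e he => ?_)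
  · rwa [IsFaceMap.faceCoboundary_join, halt.smoothedRegion_join] at h
  · have := cornerRegion_join_ne halt hconn (he.trans hb.symm)
    simp [faceCoboundary, this, smoothedRegion, he]

/-- The circle of the state with only `x`-smoothings around a region that contains neither the dot
nor the outer boundary does not go around the dot. -/
theorem Alternating.not_goesAroundDot (halt : D.Alternating) (hconn : D.Connected)
    (x : Smoothing) {b : Fin n × Fin 4} (hb : isOver b.2 = isOver x.corner)
    (hdot : D.dot ≠ D.cornerRegion b) (houter : D.outer ≠ D.cornerRegion b) :
    ¬ D.GoesAroundDot (D.stateCircle (fun _ => x) (Sum.inl b)) := by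
  classical
  have := hconn.isEmpty_loops b.1.pos
  rw [goesAroundDot_iff]
  rintro ⟨f, hf, hne⟩
  -- The circle bounds the single region at `b`, whose indicator vanishes at both the dot and the
  -- outer boundary.
  have hfg : ∀ e, faceCoboundary D.join D.cornerRegion f e = faceCoboundary D.join D.cornerRegion
      (fun r => if r = D.cornerRegion b then 1 else 0) e := fun e => by
    rw [hf, halt.faceCoboundary_single hconn x hb]
    refine if_congr ?_ rfl rfl
    rw [halt.stateCircle_const_eq_iff hconn]
    simp [smoothedRegion, hb]
  have := hconn.sub_eq_of_faceCoboundary_eq b.1.pos hfg D.dot D.outer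
  simp only [hdot, houter, if_false, sub_zero] at this
  exact hne this

/-! ### Sides of a curve along state circles, and new circles around the dot -/

theorem CurveThrough.side_eq_of_ne {c c' : Fin n} (γ : D.CurveThrough c) (hc : c' ≠ c)
    (i j : Fin 4) : γ.side (Sum.inl (c', i)) = γ.side (Sum.inl (c', j)) := by
  have h0 := γ.side_vertex c' 0 hc
  have h1 := γ.side_vertex c' 1 hc
  have h2 := γ.side_vertex c' 2 hc
  have key : ∀ i, γ.side (Sum.inl (c', i)) = γ.side (Sum.inl (c', 0)) := by
    intro i
    fin_cases i
    · rfl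
    · exact h0
    · exact h1.trans h0
    · exact h2.trans (h1.trans h0)
  rw [key i, key j]

/-- The curve runs through the corners cut off by `x`, so the opposite smoothing connects only ends
on the same side of it. -/
theorem CurveThrough.side_partner {c : Fin n} (γ : D.CurveThrough c) {x y : Smoothing}
    (hγ : γ.corner = x.corner) (hy : y ≠ x) (i : Fin 4) :
    γ.side (Sum.inl (c, y.partner i)) = γ.side (Sum.inl (c, i)) := by
  have hl := γ.side_left
  have hr := γ.side_right
  have h1 := Smoothing.partner_corner_of_ne hy
  have h2 := Smoothing.partner_corner_add_one_of_ne hy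
  have h3 : y.partner (x.corner + 3) = x.corner := by rw [← h1, y.partner_partner]
  have h4 : y.partner (x.corner + 2) = x.corner + 1 := by rw [← h2, y.partner_partner]
  rw [hγ] at hl hr
  obtain ⟨j, rfl⟩ : ∃ j, i = x.corner + j := ⟨i - x.corner, by simp⟩
  fin_cases j
  · simpa [h1] using hr
  · simpa [h2] using hl.symm
  · simpa [h4] using hl
  · simpa [h3] using hr.symm

open Classical in
/-- The edges around the region `R` of a curve through a crossing, on the side of the dot, bound the
union of the other regions on that side. -/
theorem Alternating.exists_bounding_curve (halt : D.Alternating) (hconn : D.Connected)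
    (hred : D.DottedReduced) {c : Fin n} (γ : D.CurveThrough c) {x : Smoothing}
    (hγ : γ.corner = x.corner) :
    ∃ f : Fin D.numRegions → ZMod 2, (∀ e, faceCoboundary D.join D.cornerRegion f e =
      if D.smoothedRegion x e = D.cornerRegion (c, x.corner) ∧ γ.side (Sum.inl e) = γ.dotSide
        then 1 else 0) ∧ f D.dot ≠ f D.outer := by
  obtain ⟨hsep, hdot, houter⟩ := hred.curveThrough γ
  have hreg := γ.side_region
  have hsd := γ.side_dot
  have hso := γ.side_outer
  rw [hγ] at hdot houter hreg hsd hso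
  choose rep hrep using hconn.cornerRegion_surjective c.pos
  set R := D.cornerRegion (c, x.corner)
  let f : Fin D.numRegions → ZMod 2 := fun r =>
    if r ≠ R ∧ γ.side (Sum.inl (rep r)) = γ.dotSide then 1 else 0
  have hfe : ∀ e, D.cornerRegion e ≠ R →
      f (D.cornerRegion e) = if γ.side (Sum.inl e) = γ.dotSide then 1 else 0 := by
    intro e he
    have : γ.side (Sum.inl (rep (D.cornerRegion e))) = γ.side (Sum.inl e) :=
      hreg _ _ (hrep _) ((hrep _).trans_ne he)
    simp [f, he, this]
  have hflip : ∀ e, γ.side (Sum.inl (D.join e)) = γ.side (Sum.inl e) := fun e =>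
    γ.side_flip (Sum.inl e)
  refine ⟨f, halt.forall_of_isOver x (fun e h => ?_) (fun e he => ?_), ?_⟩
  · rwa [IsFaceMap.faceCoboundary_join, halt.smoothedRegion_join, hflip] at h
  -- By the colouring only the region at `e` can be `R`. If it is not, both neighbouring regions lie
  -- on the same side and there is no jump.
  · have hj : D.cornerRegion (D.join e) ≠ R := cornerRegion_join_ne halt hconn he
    change f (D.cornerRegion e) + f (D.cornerRegion (D.join e)) = _
    rw [hfe _ hj, hflip]
    simp only [smoothedRegion, he, if_true]
    by_cases h : D.cornerRegion e = R
    · simp [h, f]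
    · rw [hfe _ h, CharTwo.add_self_eq_zero]
      simp [h]
  · have h1 : f D.dot = 1 := by
      have := hsd (Sum.inl (rep D.dot)) (hrep _) ((hrep _).trans_ne hdot)
      simp [f, hdot, this]
    have h2 : f D.outer = 0 := by
      have := hso (Sum.inl (rep D.outer)) (hrep _) ((hrep _).trans_ne houter)
      simp [f, this, hsep.symm]
    rw [h1, h2]
    decide

/-- Switching smoothings of the state with only `x`-smoothings at crossings where a circle of this
state meets itself creates additional circles that go around the dot. -/
theorem Alternating.numDotCircles_lt (halt : D.Alternating) (hconn : D.Connected)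
    (hred : D.DottedReduced) (x : Smoothing) {s : Fin n → Smoothing}
    (hs : ∀ c, s c ≠ x → D.cornerRegion (c, x.corner + 2) = D.cornerRegion (c, x.corner))
    {c : Fin n} (hc : s c ≠ x) : D.numDotCircles (fun _ => x) < D.numDotCircles s := by
  classical
  have := hconn.isEmpty_loops c.pos
  -- At a switched crossing both `x`-corners lie in one region, so all four ends share their
  -- smoothed region. Every circle of `s` thus stays on one circle of the `x`-state, which defines
  -- `π`.
  have hsm : ∀ c' i, D.smoothedRegion x (c', (s c').partner i) = D.smoothedRegion x (c', i) := by
    intro c' i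
    by_cases h : s c' = x
    · rw [h, smoothedRegion_partner]
    · have h1 := smoothedRegion_partner (D := D) x c' x.corner
      have h3 := smoothedRegion_partner (D := D) x c' (x.corner + 2)
      have h2 : D.smoothedRegion x (c', x.corner + 2) = D.smoothedRegion x (c', x.corner) := by
        rw [smoothedRegion_corner, smoothedRegion_corner_add_two, hs c' h]
      rw [x.partner_corner] at h1
      rw [x.partner_corner_add_two] at h3
      have key : ∀ i, D.smoothedRegion x (c', i) = D.smoothedRegion x (c', x.corner) := by
        intro i
        obtain ⟨j, rfl⟩ : ∃ j, i = x.corner + j := ⟨i - x.corner, by simp⟩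
        fin_cases j
        · simp
        · exact h1
        · exact h2
        · exact h3.trans h2
      rw [key, key i]
  have hπ : ∀ d e, D.StateTouch s d e →
      D.stateCircle (fun _ => x) d = D.stateCircle (fun _ => x) e := by
    rintro d _ (_ | ⟨c', i⟩)
    · exact (stateCircle_flip _ d).symm
    · rw [halt.stateCircle_const_eq_iff hconn, hsm]
  let π : D.StateCircle s → D.StateCircle fun _ => x := Quot.lift (D.stateCircle fun _ => x) hπ
  -- The circles over a dot circle `C₀` add up to `C₀` modulo two, so one of them goes around the
  -- dot.
  have hlift : ∀ C₀ : {C : D.StateCircle fun _ => x // D.GoesAroundDot C},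
      ∃ C : D.StateCircle s, π C = C₀.1 ∧ D.GoesAroundDot C := by
    rintro ⟨C₀, h⟩
    obtain ⟨f, hf, hne⟩ := (goesAroundDot_iff C₀).1 h
    exact hconn.exists_goesAroundDot c.pos {C | π C = C₀} hf hne
  choose σ hσ hσ' using hlift
  obtain ⟨γ, hγ⟩ := hconn.exists_curveThrough (hs c hc)
  obtain ⟨f, hf, hne⟩ := halt.exists_bounding_curve hconn hred γ hγ
  -- The edges around the region of `γ` on the dot's side form a union of circles of `s`. They
  -- separate the dot from the outer boundary, which yields the additional circle `C₁`.
  let K : D.Dart → Prop := Sum.elim (fun e => D.smoothedRegion x e = D.cornerRegion (c, x.corner) ∧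
    γ.side (Sum.inl e) = γ.dotSide) fun _ => False
  have hK : ∀ d e, D.StateTouch s d e → K d = K e := by
    rintro (e | ⟨l, _⟩) _ (_ | ⟨c', i⟩)
    · have := γ.side_flip (Sum.inl e)
      simp only [PDCode.flip] at this
      simp [K, PDCode.flip, halt.smoothedRegion_join, this]
    · have : γ.side (Sum.inl (c', (s c').partner i)) = γ.side (Sum.inl (c', i)) := by
        by_cases h : c' = c
        · subst h
          exact γ.side_partner hγ hc i
        · exact γ.side_eq_of_ne h _ _
      simp [K, hsm, this]
    · exact isEmptyElim l
  obtain ⟨C₁, hC₁, hC₁'⟩ := hconn.exists_goesAroundDot c.pos {C | Quot.lift K hK C}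
    (fun e => (hf e).trans (if_congr Iff.rfl rfl rfl)) hne
  have hπC₁ : π C₁ = D.stateCircle (fun _ => x) (Sum.inl (c, x.corner)) := by
    obtain ⟨e | ⟨l, _⟩, rfl⟩ := stateCircle_surjective s C₁
    · refine (halt.stateCircle_const_eq_iff hconn x _ _).2 ?_
      rw [smoothedRegion_corner]
      exact hC₁.1
    · exact isEmptyElim l
  have hnot : ¬ D.GoesAroundDot (π C₁) := by
    obtain ⟨-, hdot, houter⟩ := hred.curveThrough γ
    rw [hγ] at hdot houter
    rw [hπC₁]
    exact halt.not_goesAroundDot hconn x rfl hdot houter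
  -- The circle `C₁` differs from all the lifts because its image under `π` does not go around the
  -- dot.
  let ι : Option {C : D.StateCircle fun _ => x // D.GoesAroundDot C} →
      {C : D.StateCircle s // D.GoesAroundDot C} := fun o =>
    o.elim ⟨C₁, hC₁'⟩ fun C => ⟨σ C, hσ' C⟩
  have hι : Function.Injective ι := by
    rintro (_ | C) (_ | C') h
    · rfl
    · exact absurd (by rw [show C₁ = σ C' from congrArg Subtype.val h, hσ]; exact C'.2) hnot
    · exact absurd (by rw [← show σ C = C₁ from congrArg Subtype.val h, hσ]; exact C.2) hnot
    · have : σ C = σ C' := congrArg Subtype.val h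
      exact congrArg some (Subtype.ext (by rw [← hσ C, ← hσ C', this]))
  have := Nat.card_le_card_of_injective ι hι
  rw [Finite.card_option] at this
  exact this

/-! ### The extreme coefficients of the bracket -/

/-- The sign with which a smoothing contributes to the exponent of `A`. -/
def _root_.Smoothing.sign : Smoothing → ℤ
  | .A => 1
  | .B => -1

theorem _root_.Smoothing.sign_eq (x : Smoothing) : x.sign = 1 ∨ x.sign = -1 := by
  cases x <;> simp [Smoothing.sign]

theorem numSmoothings_sub (s : Fin n → Smoothing) (x : Smoothing) :
    (numSmoothings s .A : ℤ) - numSmoothings s .B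
      = x.sign * (n - 2 * (Finset.univ.filter fun c => s c ≠ x).card) := by
  have h := Finset.card_filter_add_card_filter_not (s := Finset.univ) fun c => s c = .A
  have hA : ∀ c, s c ≠ .A ↔ s c = .B := fun c => by cases s c <;> simp
  have hB : ∀ c, s c ≠ .B ↔ s c = .A := fun c => by cases s c <;> simp
  simp only [Finset.card_univ, Fintype.card_fin, hA] at h
  unfold numSmoothings
  cases x
  · simp only [hA, Smoothing.sign]
    omega
  · simp only [hB, Smoothing.sign]
    omega

theorem coeff_contribution (s : Fin n → Smoothing) (x : Smoothing) (k : ℤ) :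
    (D.contribution s).coeff (x.sign * k) =
      (loopValue ^ (D.numCircles s - 1)).coeff (x.sign *
        (k - (n - 2 * (Finset.univ.filter fun c => s c ≠ x).card))) *
        Polynomial.X ^ D.numDotCircles s := by
  rw [contribution, LaurentPolynomial.coeff_mul_C, mul_comm (LaurentPolynomial.T _),
    LaurentPolynomial.coeff_mul_T, numSmoothings_sub s x, ← mul_sub]
  rfl

variable (D) in
/-- The extreme exponent of `A`, up to sign, of the state with only `x`-smoothings. -/
noncomputable def extremeExponent (x : Smoothing) : ℤ :=
  n + 2 * ((D.numCircles fun _ => x) - 1 : ℤ)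

theorem coeff_contribution_of_lt (s : Fin n → Smoothing) (x : Smoothing) {k : ℤ}
    (hk : n - 2 * ((Finset.univ.filter fun c => s c ≠ x).card : ℤ)
      + 2 * ((D.numCircles s : ℤ) - 1) < k) :
    (D.contribution s).coeff (x.sign * k) = 0 := by
  -- At least one circle exists, so the natural subtraction in the exponent of the loop value is not
  -- truncated.
  have := D.one_le_numCircles s
  rw [coeff_contribution, (coeff_loopValue_pow x.sign_eq _).2 _ (by push_cast [this]; linarith),
    zero_mul]

theorem coeff_bracket (D : SolidTorusDiagram n) (k : ℤ) :
    D.bracket.coeff k = ∑ s : Fin n → Smoothing, (D.contribution s).coeff k := by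
  rw [bracket, AddMonoidAlgebra.coeff_sum, Finsupp.finsetSum_apply]

theorem coeff_bracket_of_lt (x : Smoothing) {k : ℤ} (hk : D.extremeExponent x < k) :
    D.bracket.coeff (x.sign * k) = 0 := by
  rw [coeff_bracket]
  refine Finset.sum_eq_zero fun s _ => coeff_contribution_of_lt s x ?_
  have := D.numCircles_le_add_card (fun _ => x) s
  unfold extremeExponent at hk
  omega

/-- In the extreme coefficient, the power of `t` belonging to the `x`-state receives a contribution
from that state only, and this is a sign. -/
theorem Alternating.coeff_bracket_extremeExponent_ne_zero (halt : D.Alternating)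
    (hconn : D.Connected) (hred : D.DottedReduced) (x : Smoothing) :
    D.bracket.coeff (x.sign * D.extremeExponent x) ≠ 0 := by
  classical
  intro h
  have h' := congrArg (fun q => q.coeff (D.numDotCircles fun _ => x)) h
  simp only [coeff_bracket, Polynomial.finsetSum_coeff, Polynomial.coeff_zero] at h'
  rw [Finset.sum_eq_single fun _ => x] at h'
  · have h1 := D.one_le_numCircles fun _ => x
    have e : D.extremeExponent x
        - (n - 2 * ((Finset.univ.filter fun c : Fin n => (fun _ => x) c ≠ x).card : ℤ))
        = 2 * ((D.numCircles fun _ => x) - 1 : ℕ) := by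
      simp [extremeExponent, h1]
    rw [coeff_contribution, e, (coeff_loopValue_pow x.sign_eq _).1, ← Polynomial.C_1,
      ← Polynomial.C_neg, ← Polynomial.C_pow, Polynomial.coeff_C_mul, Polynomial.coeff_X_pow_self,
      mul_one] at h'
    exact pow_ne_zero _ (by norm_num) h'
  · intro s _ hsx
    -- Either all changes are at self-meetings of regions, and the power of `t` is too large, or one
    -- change joins two circles and the exponent of `A` falls short.
    by_cases hs : ∀ c, s c ≠ x → D.cornerRegion (c, x.corner + 2) = D.cornerRegion (c, x.corner)
    · obtain ⟨c, hc⟩ := Function.ne_iff.1 hsx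
      have hlt := halt.numDotCircles_lt hconn hred x hs hc
      rw [coeff_contribution, Polynomial.coeff_mul_X_pow', if_neg (not_le.2 hlt)]
    · push Not at hs
      obtain ⟨c, hc, hne⟩ := hs
      have h1 : D.numCircles (Function.update (fun _ => x) c (s c)) < D.numCircles fun _ => x := by
        refine numCircles_update_lt hc fun h => hne ?_
        rw [halt.stateCircle_const_eq_iff hconn, smoothedRegion_corner,
          smoothedRegion_corner_add_two] at h
        exact h
      have h2 := D.numCircles_le_add_card (Function.update (fun _ => x) c (s c)) s
      have h3 : (Finset.univ.filter fun c' => s c' ≠ Function.update (fun _ => x) c (s c) c')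
          = (Finset.univ.filter fun c' => s c' ≠ x).erase c := by
        ext c'
        by_cases h : c' = c
        · subst h; simp
        · simp [h]
      have h4 : c ∈ Finset.univ.filter fun c' => s c' ≠ x := by simpa using hc
      have h5 := Finset.card_erase_add_one h4
      rw [h3] at h2
      rw [coeff_contribution_of_lt s x, Polynomial.coeff_zero]
      unfold extremeExponent
      omega
  · simp

end SolidTorusDiagram

/-! ### The span of the bracket -/

theorem theorem3p3 {n : ℕ} (D : SolidTorusDiagram n) (hconn : D.Connected)
    (halt : D.Alternating) (hred : D.DottedReduced) :
    D.bracket ≠ 0 ∧ spanA D.bracket = 4 * (n : ℤ) := by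
  have hA := halt.coeff_bracket_extremeExponent_ne_zero hconn hred .A
  have hB := halt.coeff_bracket_extremeExponent_ne_zero hconn hred .B
  simp only [Smoothing.sign, one_mul, neg_mul] at hA hB
  refine ⟨fun h => hA (by rw [h]; rfl), ?_⟩
  have hmax : maxDegA D.bracket = D.extremeExponent .A := by
    refine IsGreatest.csSup_eq ⟨hA, fun k hk => ?_⟩
    by_contra! h
    have := SolidTorusDiagram.coeff_bracket_of_lt .A h
    simp only [Smoothing.sign, one_mul] at this
    exact hk this
  have hmin : minDegA D.bracket = -D.extremeExponent .B := by
    refine IsLeast.csInf_eq ⟨hB, fun k hk => ?_⟩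
    by_contra! h
    have := SolidTorusDiagram.coeff_bracket_of_lt (D := D) .B (k := -k) (by linarith)
    simp only [Smoothing.sign, neg_mul, one_mul, neg_neg] at this
    exact hk this
  -- The extreme exponents add up to `2 * n + 2 * (n + 2) - 4`.
  have hsum := halt.numCircles_const_add hconn
  rw [spanA, hmax, hmin]
  unfold SolidTorusDiagram.extremeExponent
  omega
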